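/- **Theorem 1 (Full-Diversity Design Criterion).** Let $n_t,n_r,T,K\ge 1$ be integers and let $\mathbf D_1,\dots,\mathbf D_{2K}\in\mathbb C^{n_t\times T}$ be the weight matrices of a linear design $\mathbf X(\mathbf x)=\sum_{k=1}^{2K}x_k\mathbf D_k$, linearly independent over $\mathbb Z$ (distinct integer vectors give distinct codewords). Let $\mathcal C_\infty=\{\mathbf X(\mathbf d):\mathbf d\in\mathbb Z^{2K}\}$, and assume the non-vanishing singular value property $$\sigma_{\min}(\mathcal C_\infty)=\inf_{\mathbf X\in\mathcal C_\infty,\ \mathbf X\ne 0}\ \min_{1\le j\le n_t}\sigma_j(\mathbf X)\neq 0,$$ where $\sigma_1(\mathbf X),\dots,\sigma_{n_t}(\mathbf X)$ are the square roots of the eigenvalues of $\mathbf X\mathbf X^H$. *Channel.* Let $q=\sqrt M=2^k$ with $k\ge1$, $\mathcal S=\{0,1,\dots,q-1\}$, let $\tau\in\mathbb R$ be a shift of the constellation, and let $\bar E=\frac1q\sum_{x\in\mathcal S}(x-\tau)^2$ be the average energy of the shifted constellation. For $\mathbf s\in\mathcal S^{2K}$ and $P>0$ the received matrix is $$\mathbf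 Y=\sqrt{P/n_t}\;\mathbf H\,\mathbf X(\mathbf s-\tau\mathbf 1)+\mathbf Z,$$ where $\mathbf H\in\mathbb C^{n_r\times n_t}$ and $\mathbf Z\in\mathbb C^{n_r\times T}$ are independent with i.i.d. entries $\mathcal N_c(0,1)$. Let $\mathbf y\in\mathbb R^{2n_rT}$ be the vector of real and imaginary parts of $\sqrt{n_t/P}\,\mathbf Y$; then $\mathbf y=\mathcal H(\mathbf s-\tau\mathbf 1)+\sqrt{n_t/P}\,\mathbf z$, where $\mathbf z$ is the vector of real and imaginary parts of $\mathbf Z$, $\mathcal H=(\mathbf H'\otimes\mathbf I_T)\mathbf R$, $\mathbf H'=\begin{bmatrix}\mathrm{Re}\,\mathbf H&-\mathrm{Im}\,\mathbf H\\ \mathrm{Im}\,\mathbf H&\mathrm{Re}\,\mathbf H\end{bmatrix}$, and the columns of $\mathbf R\in\mathbb R^{2n_tT\times 2K}$ are the vectorized $\mathbf D_k$. *Receiver.* Depending on $\mathbf H$ and $P$, the integer-forcing receiver uses $\mathbf A\in\mathbb Z^{2K\times 2K}$, invertible over $\mathbb Z/q$, and $\mathbf B\in\mathbb R^{2K\times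 2n_rT}$, with rows $\mathbf a_m,\mathbf b_m$. They are optimal in one of two senses: either $(\mathbf A,\mathbf B)$ minimizes the largest effective noise power $$\max_m\Big(\|\mathbf b_m\mathcal H-\mathbf a_m\|^2\bar E+\tfrac{n_t}{2P}\|\mathbf b_m\|^2\Big)$$ among all such pairs; or (high-SNR form) $\mathbf B=\mathbf A\mathcal H^{+}$ with the pseudo-inverse $\mathcal H^{+}=(\mathcal H^T\mathcal H)^{-1}\mathcal H^T$, and $\mathbf A$ minimizes $\max_m\|\mathbf a_m\mathcal H^{+}\|^2$ among the integer matrices invertible over $\mathbb Z/q$. Step 1 of the decoder computes $\hat{\mathbf y}=\lfloor\mathbf B\mathbf y+\mathbf A\tau\mathbf 1\rceil$ by componentwise rounding to the nearest integer. *Conclusion.* There is a constant $c'$ which, for given $n_t,n_r,T,K$, depends only on $\mathcal C_\infty$ (not on $q$, $\tau$, $\mathbf s$, $P$ or the choice of the optimal receiver) such that for every $\mathbf s\in\mathcal S^{2K}$ and every $P>0$ $$\Pr(\hat{\mathbf y}\ne\mathbf A\mathbf s)=\mathbb E_{\mathbf H}\big[\Pr(\hat{\mathbf y}\ne\mathbf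 A\mathbf s\mid\mathbf H)\big]\le\frac{c'}{P^{n_tn_r}} .$$ In particular the finite code $\{\mathbf X(\mathbf s):\mathbf s\in\mathcal S^{2K}\}$ has full diversity with the integer-forcing receiver: $$\liminf_{P\to\infty}\frac{-\log\Pr(\hat{\mathbf y}\neq\mathbf A\mathbf s)}{\log P}\ge n_tn_r .$$ -/

import Mathlib

open MeasureTheory ProbabilityTheory Filter
open scoped Matrix Kronecker ENNReal NNReal

noncomputable section

namespace IFReceiver

/-! ### Linear designs and the non-vanishing singular value property -/

/-- The codeword `X(s) = ∑ k, s k • D k` of the linear design with weight matrices `D`. -/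
def codeword {nt T K : ℕ} (D : Fin (2 * K) → Matrix (Fin nt) (Fin T) ℂ)
    (s : Fin (2 * K) → ℝ) : Matrix (Fin nt) (Fin T) ℂ :=
  ∑ k, (s k : ℂ) • D k

/-- The infinite code: all codewords with integer symbols. -/
def infiniteCode {nt T K : ℕ} (D : Fin (2 * K) → Matrix (Fin nt) (Fin T) ℂ) :
    Set (Matrix (Fin nt) (Fin T) ℂ) :=
  {X | ∃ d : Fin (2 * K) → ℤ, X = codeword D (fun k => (d k : ℝ))}

/-- The `j`-th singular value of an `nt × T` matrix, `j` running over the `nt` rows: the square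
root of the `j`-th eigenvalue of `X Xᴴ`. -/
def singularValue {nt T : ℕ} (X : Matrix (Fin nt) (Fin T) ℂ) (j : Fin nt) : ℝ :=
  √((Matrix.isHermitian_mul_conjTranspose_self X).eigenvalues j)

/-- The minimum singular value of a matrix. -/
def sigmaMin {nt T : ℕ} (X : Matrix (Fin nt) (Fin T) ℂ) : ℝ :=
  ⨅ j, singularValue X j

/-- The minimum singular value of a code: the infimum over its nonzero codewords. -/
def codeSigmaMin {nt T : ℕ} (C : Set (Matrix (Fin nt) (Fin T) ℂ)) : ℝ :=
  sInf (sigmaMin '' {X | X ∈ C ∧ X ≠ 0})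

/-- The non-vanishing singular value property of a linear design. -/
def NVS {nt T K : ℕ} (D : Fin (2 * K) → Matrix (Fin nt) (Fin T) ℂ) : Prop :=
  codeSigmaMin (infiniteCode D) ≠ 0

/-! ### The constellation -/

/-- The constellation `{0, 1, …, q - 1}`, where `q = √M`. -/
def constellation (q : ℕ) : Finset ℤ := Finset.Ico 0 (q : ℤ)

/-- The average energy of the constellation `{0, 1, …, q - 1}` after a shift by `-τ`. -/
def avgEnergy (q : ℕ) (τ : ℝ) : ℝ :=
  (∑ x ∈ constellation q, ((x : ℝ) - τ) ^ 2) / q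

/-! ### The real linear model -/

/-- Index set of the real components of a complex `n × T` matrix (`inl`: real parts, `inr`:
imaginary parts). -/
abbrev RIdx (n T : ℕ) : Type := (Fin n ⊕ Fin n) × Fin T

/-- Stacking of the real and imaginary parts of a complex matrix into a real vector. -/
def vecReal {n T : ℕ} (Y : Matrix (Fin n) (Fin T) ℂ) : RIdx n T → ℝ
  | (Sum.inl j, t) => (Y j t).re
  | (Sum.inr j, t) => (Y j t).im

/-- The code matrix: its `k`-th column is the vectorized weight matrix `D k`. -/
def codeMatrix {nt T K : ℕ} (D : Fin (2 * K) → Matrix (Fin nt) (Fin T) ℂ) :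
    Matrix (RIdx nt T) (Fin (2 * K)) ℝ :=
  Matrix.of fun i k => vecReal (D k) i

/-- The real form `[Re H, -Im H; Im H, Re H]` of the channel matrix. -/
def realChannel {nr nt : ℕ} (H : Matrix (Fin nr) (Fin nt) ℂ) :
    Matrix (Fin nr ⊕ Fin nr) (Fin nt ⊕ Fin nt) ℝ :=
  Matrix.fromBlocks (H.map Complex.re) (-H.map Complex.im) (H.map Complex.im) (H.map Complex.re)

/-- The effective real channel `(H' ⊗ I_T) R`. -/
def effChannel {nr nt T K : ℕ} (D : Fin (2 * K) → Matrix (Fin nt) (Fin T) ℂ)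
    (H : Matrix (Fin nr) (Fin nt) ℂ) : Matrix (RIdx nr T) (Fin (2 * K)) ℝ :=
  (realChannel H ⊗ₖ (1 : Matrix (Fin T) (Fin T) ℝ)) * codeMatrix D

/-- The received matrix `Y = √(P / nt) H X(x) + Z` for the transmitted real symbols `x`. -/
def received {nr nt T K : ℕ} (D : Fin (2 * K) → Matrix (Fin nt) (Fin T) ℂ) (P : ℝ)
    (H : Matrix (Fin nr) (Fin nt) ℂ) (x : Fin (2 * K) → ℝ) (Z : Matrix (Fin nr) (Fin T) ℂ) :
    Matrix (Fin nr) (Fin T) ℂ :=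
  ((√(P / nt) : ℝ) : ℂ) • (H * codeword D x) + Z

/-- The real received vector after the scaling by `√(nt / P)`. -/
def receivedVec {nr nt T K : ℕ} (D : Fin (2 * K) → Matrix (Fin nt) (Fin T) ℂ) (P : ℝ)
    (H : Matrix (Fin nr) (Fin nt) ℂ) (x : Fin (2 * K) → ℝ) (Z : Matrix (Fin nr) (Fin T) ℂ) :
    RIdx nr T → ℝ :=
  √(nt / P) • vecReal (received D P H x Z)

/-! ### The integer-forcing receiver -/

/-- A linear receiver: the integer matrix `A` and the filtering matrix `B`. -/
structure Receiver (nr T K : ℕ) where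
  A : Matrix (Fin (2 * K)) (Fin (2 * K)) ℤ
  B : Matrix (Fin (2 * K)) (RIdx nr T) ℝ

/-- The integer matrix `A` is invertible over the ring `ℤ / q`. -/
def InvertibleOver {K : ℕ} (q : ℕ) (A : Matrix (Fin (2 * K)) (Fin (2 * K)) ℤ) : Prop :=
  IsUnit (A.map (Int.cast : ℤ → ZMod q))

/-- The effective noise power `‖b 𝓗 - a‖² E + nt / (2 P) ‖b‖²` of a layer. -/
def noisePower {nr T K : ℕ} (nt : ℕ) (G : Matrix (RIdx nr T) (Fin (2 * K)) ℝ) (E P : ℝ)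
    (a : Fin (2 * K) → ℤ) (b : RIdx nr T → ℝ) : ℝ :=
  (∑ k, ((b ᵥ* G) k - a k) ^ 2) * E + nt / (2 * P) * ∑ i, b i ^ 2

/-- The optimal integer-forcing receiver for the effective channel `G`: among all integer matrices
invertible over `ℤ / q` and all filtering matrices, it makes the largest effective noise power of
a layer as small as possible. -/
def IsOptimal {nr T K : ℕ} (nt q : ℕ) (G : Matrix (RIdx nr T) (Fin (2 * K)) ℝ) (E P : ℝ)
    (r : Receiver nr T K) : Prop :=
  InvertibleOver q r.A ∧
    ∀ r' : Receiver nr T K, InvertibleOver q r'.A →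
      ∀ m, ∃ m', noisePower nt G E P (r.A m) (r.B m) ≤ noisePower nt G E P (r'.A m') (r'.B m')

/-- The pseudo-inverse `(𝓗ᵀ 𝓗)⁻¹ 𝓗ᵀ` of a matrix of full column rank. -/
def pinv {nr T K : ℕ} (G : Matrix (RIdx nr T) (Fin (2 * K)) ℝ) :
    Matrix (Fin (2 * K)) (RIdx nr T) ℝ :=
  (Gᵀ * G)⁻¹ * Gᵀ

/-- The high-SNR form of the optimal receiver: `B = A 𝓗⁻¹` with the pseudo-inverse, so that the
quantization noise vanishes and the noise power of layer `m` is `nt / (2 P) ‖a_m 𝓗⁻¹‖²`; among all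
integer matrices invertible over `ℤ / q`, `A` makes the largest of these as small as possible. -/
def IsHighSNROptimal {nr T K : ℕ} (q : ℕ) (G : Matrix (RIdx nr T) (Fin (2 * K)) ℝ)
    (r : Receiver nr T K) : Prop :=
  InvertibleOver q r.A ∧ r.B = r.A.map (Int.cast : ℤ → ℝ) * pinv G ∧
    ∀ A' : Matrix (Fin (2 * K)) (Fin (2 * K)) ℤ, InvertibleOver q A' →
      ∀ m, ∃ m', ∑ i, r.B m i ^ 2 ≤ ∑ i, (A'.map (Int.cast : ℤ → ℝ) * pinv G) m' i ^ 2

/-- Input of the quantizer when the symbols `s` are shifted by `-τ` for transmission and the shift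
is reverted at the receiver:
`B y + A (τ, …, τ) = A s + (B 𝓗 - A) (s - τ) + √(nt / P) B z`. -/
def filtered {nr nt T K : ℕ} (D : Fin (2 * K) → Matrix (Fin nt) (Fin T) ℂ) (P τ : ℝ)
    (r : Receiver nr T K) (H : Matrix (Fin nr) (Fin nt) ℂ) (s : Fin (2 * K) → ℤ)
    (Z : Matrix (Fin nr) (Fin T) ℂ) : Fin (2 * K) → ℝ :=
  r.B *ᵥ receivedVec D P H (fun k => (s k : ℝ) - τ) Z + r.A.map (Int.cast : ℤ → ℝ) *ᵥ fun _ => τ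

/-- Step 1 of the decoder: componentwise rounding to the nearest integer. -/
def step1 {nr nt T K : ℕ} (D : Fin (2 * K) → Matrix (Fin nt) (Fin T) ℂ) (P τ : ℝ)
    (r : Receiver nr T K) (H : Matrix (Fin nr) (Fin nt) ℂ) (s : Fin (2 * K) → ℤ)
    (Z : Matrix (Fin nr) (Fin T) ℂ) : Fin (2 * K) → ℤ :=
  fun m => round (filtered D P τ r H s Z m)

/-! ### Fading, noise, error probability and diversity -/

/-- The circularly symmetric complex Gaussian distribution of mean zero and unit variance: real
and imaginary parts are independent with variance `1 / 2`. -/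
def complexGaussian : Measure ℂ :=
  ((gaussianReal 0 (1 / 2)).prod (gaussianReal 0 (1 / 2))).map
    Complex.measurableEquivRealProd.symm

/-- The law of an `m × n` matrix with i.i.d. entries `complexGaussian`. -/
def gaussianMatrix (m n : ℕ) : Measure (Fin m → Fin n → ℂ) :=
  Measure.pi fun _ => Measure.pi fun _ => complexGaussian

/-- The error probability of Step 1 for the transmitted symbol vector `s`, averaged over the
channel: the expectation over `H` of the conditional probability, over the noise, of
`step1 ≠ A s`. The receiver may depend on the channel. -/
def errorProb {nr nt T K : ℕ} (D : Fin (2 * K) → Matrix (Fin nt) (Fin T) ℂ) (P τ : ℝ)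
    (r : Matrix (Fin nr) (Fin nt) ℂ → Receiver nr T K) (s : Fin (2 * K) → ℤ) : ℝ≥0∞ :=
  ∫⁻ H, gaussianMatrix nr T
      {Z | step1 D P τ (r (Matrix.of H)) (Matrix.of H) s (Matrix.of Z) ≠
        (r (Matrix.of H)).A *ᵥ s}
    ∂(gaussianMatrix nr nt)

/-- The diversity order of an error probability as a function of the SNR: its decay exponent
`liminf_{P → ∞} (- log pe(P) / log P)`. -/
def diversityOrder (pe : ℝ → ℝ≥0∞) : EReal :=
  liminf (fun P : ℝ => -ENNReal.log (pe P) / ((Real.log P : ℝ) : EReal)) atTop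

end IFReceiver

end

/-! Let σ be the minimum singular value of the infinite code, 𝓗 the effective channel and ‖H‖ the
Frobenius norm. Since ‖HX‖² = tr(H X Xᴴ Hᴴ) and X Xᴴ - σ² I is positive semidefinite for every
nonzero codeword, all nonzero points of the received lattice 𝓗 ℤ^(2K) have norm at least l = σ‖H‖
(`sq_mul_frobenius_le_effChannel`).

Reduction theory gives this lattice a basis whose dual vectors have norm at most C / l, with C
depending on the rank only (`exists_basis_coord_le`). These dual vectors are the rows a_m 𝓗⁺ of a
unimodular matrix A. Such an A is invertible over every ℤ/q, so (A, A 𝓗⁺) is an admissible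
competitor without quantization noise. Hence both kinds of optimal receiver have noise power at most
v = nt C² / (2 P l²), uniformly in q and τ (`exists_noisePower_le`).

Given H, the squared quantization noise is at most 12 K v, because each constellation point has at
most six times the average energy. Once this noise is at most 1/4, a rounding error forces a
Gaussian variable of variance at most v past 1/4. This gives a conditional bound proportional to
exp(-1/(32 v)) = exp(-t‖H‖²), with t a multiple of σ² P (`gaussianMatrix_step1_ne_le`). As ‖H‖² is a
sum of nt nr independent exponential variables, averaging over H gives (1 + t)^(-nt nr), which is at
most t^(-nt nr) (`lintegral_exp_neg_frobenius`). -/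

namespace IFReceiver

/-! ### Lattices with a short dual basis -/

/-- Size reduction: adding an integer multiple of `v` makes the component along `v` small. -/
theorem exists_int_abs_inner_sub_le {V : Type*} [NormedAddCommGroup V] [InnerProductSpace ℝ V]
    (v w : V) : ∃ k : ℤ, |inner ℝ v (w - k • v)| ≤ ‖v‖ ^ 2 / 2 := by
  by_cases hv : v = 0
  · exact ⟨0, by simp [hv]⟩
  have hv2 : 0 < ‖v‖ ^ 2 := by positivity
  refine ⟨round (inner ℝ v w / ‖v‖ ^ 2), ?_⟩
  have h := abs_sub_round (inner ℝ v w / ‖v‖ ^ 2)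
  have e : inner ℝ v (w - round (inner ℝ v w / ‖v‖ ^ 2) • v) =
      (inner ℝ v w / ‖v‖ ^ 2 - round (inner ℝ v w / ‖v‖ ^ 2)) * ‖v‖ ^ 2 := by
    rw [← Int.cast_smul_eq_zsmul ℝ, inner_sub_right, inner_smul_right,
      real_inner_self_eq_norm_sq]
    field_simp
  rw [e, abs_mul, abs_of_pos hv2]
  nlinarith

/-- The orthogonal projection off the line of `v` of a vector whose component along `v` is small. -/
theorem norm_sq_sub_le_norm_starProjection_sq {V : Type*} [NormedAddCommGroup V]
    [InnerProductSpace ℝ V] (v w : V) (h : |inner ℝ v w| ≤ ‖v‖ ^ 2 / 2) :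
    ‖w‖ ^ 2 - ‖v‖ ^ 2 / 4 ≤ ‖(ℝ ∙ v)ᗮ.starProjection w‖ ^ 2 := by
  have h1 := Submodule.norm_sq_eq_add_norm_sq_starProjection w (ℝ ∙ v)
  have h2 : ‖(ℝ ∙ v).starProjection w‖ ^ 2 ≤ ‖v‖ ^ 2 / 4 := by
    by_cases hv : v = 0
    · subst hv; simp
    have hv2 : 0 < ‖v‖ := by positivity
    rw [Submodule.starProjection_singleton, norm_smul]
    have e : ‖((inner ℝ v w : ℝ) / ((‖v‖ ^ 2 : ℝ)) : ℝ)‖ ≤ 1 / 2 := by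
      rw [norm_div, Real.norm_eq_abs, Real.norm_eq_abs, abs_of_pos (by positivity : 0 < ‖v‖ ^ 2),
        div_le_iff₀ (by positivity)]
      linarith
    have e' := mul_le_mul_of_nonneg_right e hv2.le
    calc _ ≤ (1 / 2 * ‖v‖) ^ 2 := pow_le_pow_left₀ (by positivity) e' 2
      _ = _ := by ring
  linarith

/-- An abelian group that maps to a real vector space without short nonzero images is torsion
free. -/
theorem isTorsionFree_of_le_norm {Λ V : Type*} [AddCommGroup Λ] [NormedAddCommGroup V]
    [InnerProductSpace ℝ V] (φ : Λ →ₗ[ℤ] V) {l : ℝ} (hl : 0 < l)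
    (hd : ∀ d, d ≠ 0 → l ≤ ‖φ d‖) : Module.IsTorsionFree ℤ Λ := by
  have hinj : Function.Injective φ := by
    rw [injective_iff_map_eq_zero]
    intro d h0
    by_contra hne
    have := hd d hne
    rw [h0, norm_zero] at this
    linarith
  have : Module.IsTorsionFree ℤ V := Module.IsTorsionFree.trans_faithfulSMul ℤ ℝ V
  exact hinj.moduleIsTorsionFree φ (fun k d => map_zsmul φ k d)

/-- A lattice in a Euclidean space whose nonzero vectors have norm at least `l` has a basis in
which all coordinates of a vector `y` of its span are at most `C / l * ‖y‖`, that is, a basis whose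
dual basis consists of vectors of norm at most `C / l`. The constant depends on the rank only. -/
theorem exists_basis_coord_le (n : ℕ) :
    ∃ C : ℝ, 0 < C ∧ ∀ (Λ : Type) [AddCommGroup Λ] [Module.Finite ℤ Λ] (V : Type)
      [NormedAddCommGroup V] [InnerProductSpace ℝ V] (φ : Λ →ₗ[ℤ] V) (l : ℝ),
      Module.finrank ℤ Λ = n → 0 < l → (∀ d, d ≠ 0 → l ≤ ‖φ d‖) →
      ∃ c : Fin n → Λ, Submodule.span ℤ (Set.range c) = ⊤ ∧
        ∀ (x : Fin n → ℝ) (m : Fin n), l * |x m| ≤ C * ‖∑ i, x i • φ (c i)‖ := by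
  induction n with
  | zero =>
    refine ⟨1, one_pos, fun Λ _ _ V _ _ φ l hr hl hd => ⟨Fin.elim0, ?_, fun x m => m.elim0⟩⟩
    -- Rank zero forces the group to be trivial only once torsion is excluded.
    have := isTorsionFree_of_le_norm φ hl hd
    have : Subsingleton Λ := Module.finrank_zero_iff.mp hr
    exact Subsingleton.elim _ _
  | succ n ih =>
    obtain ⟨C, hC, ih⟩ := ih
    -- The constant dominates both 2C, for the coordinates seen after projection, and 1 + nC, for
    -- the coordinate along `v`.
    refine ⟨1 + (n + 2) * C, by positivity, fun Λ _ _ V _ _ φ l hr hl hd => ?_⟩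
    have := isTorsionFree_of_le_norm φ hl hd
    have hnt : Nontrivial Λ := Module.nontrivial_of_finrank_pos (R := ℤ) (by omega)
    obtain ⟨d₀, hd₀⟩ := exists_ne (0 : Λ)
    set S : Set ℝ := (fun d => ‖φ d‖) '' {d | d ≠ 0} with hS
    have hSne : S.Nonempty := ⟨_, d₀, hd₀, rfl⟩
    have hSbd : BddBelow S := ⟨l, by rintro _ ⟨d, h, rfl⟩; exact hd d h⟩
    have hlS : l ≤ sInf S := le_csInf hSne (by rintro _ ⟨d, h, rfl⟩; exact hd d h)
    have hmin : ∀ d, d ≠ 0 → sInf S ≤ ‖φ d‖ := fun d h => csInf_le hSbd ⟨d, h, rfl⟩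
    -- A nearly shortest vector is enough, so the infimum need not be shown to be attained.
    obtain ⟨_, ⟨v, hv0, rfl⟩, hv⟩ := exists_lt_of_csInf_lt hSne
      (show sInf S < 3 / 2 * sInf S by linarith)
    simp only at hv
    have hlv : l ≤ ‖φ v‖ := hd v hv0
    set N : Submodule ℤ Λ := ℤ ∙ v with hN
    set π : V →ₗ[ℤ] V := ((ℝ ∙ φ v)ᗮ.starProjection : V →ₗ[ℝ] V).restrictScalars ℤ with hπ
    have hπv : π (φ v) = 0 := by
      have : (ℝ ∙ φ v)ᗮ.starProjection (φ v) = 0 := by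
        rw [Submodule.starProjection_apply_eq_zero_iff, Submodule.orthogonal_orthogonal]
        exact Submodule.mem_span_singleton_self _
      exact this
    let φ' : (Λ ⧸ N) →ₗ[ℤ] V := N.liftQ (π ∘ₗ φ) (by
      rw [hN, Submodule.span_singleton_le_iff_mem, LinearMap.mem_ker]
      exact hπv)
    have hlift : ∀ q : Λ ⧸ N, ∃ w : Λ, N.mkQ w = q ∧
        |inner ℝ (φ v) (φ w)| ≤ ‖φ v‖ ^ 2 / 2 := by
      intro q
      obtain ⟨w, rfl⟩ := N.mkQ_surjective q
      obtain ⟨k, hk⟩ := exists_int_abs_inner_sub_le (φ v) (φ w)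
      refine ⟨w - k • v, ?_, ?_⟩
      · rw [map_sub, sub_eq_self, Submodule.mkQ_apply, Submodule.Quotient.mk_eq_zero]
        exact N.smul_mem k (Submodule.mem_span_singleton_self v)
      · rwa [map_sub, map_zsmul]
    have hrank : Module.finrank ℤ (Λ ⧸ N) = n := by
      have h1 := Submodule.finrank_quotient_add_finrank (R := ℤ) N
      have h2 : Module.finrank ℤ N = 1 := by
        rw [hN]
        exact (LinearEquiv.toSpanNonzeroSingleton ℤ Λ v hv0).finrank_eq.symm.trans
          (Module.finrank_self ℤ)
      omega
    -- With s = `sInf S`, a size-reduced representative has norm at least s, while ‖φ v‖ < 3s/2. Its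
    -- projection off φ v therefore has squared norm at least (1 - 9/16)s² ≥ (s/2)², so the quotient
    -- lattice keeps the lower bound l/2.
    obtain ⟨c, hcs, hc⟩ := ih (Λ ⧸ N) V φ' (l / 2) hrank (by positivity) (by
      intro q hq
      obtain ⟨w, rfl, hw⟩ := hlift q
      have hw0 : w ≠ 0 := by rintro rfl; simp at hq
      have h1 := norm_sq_sub_le_norm_starProjection_sq (φ v) (φ w) hw
      have h2 := hmin w hw0
      have e : φ' (N.mkQ w) = (ℝ ∙ φ v)ᗮ.starProjection (φ w) := rfl
      rw [e]
      have : sInf S / 2 ≤ ‖(ℝ ∙ φ v)ᗮ.starProjection (φ w)‖ := by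
        refine le_of_sq_le_sq ?_ (norm_nonneg _)
        nlinarith [norm_nonneg (φ v)]
      linarith)
    choose w hwq hwi using fun i => hlift (c i)
    refine ⟨Fin.cons v w, ?_, ?_⟩
    · rw [Fin.range_cons, Submodule.span_insert, ← hN]
      have hmap : (Submodule.span ℤ (Set.range w)).map N.mkQ = ⊤ := by
        rw [Submodule.map_span, ← hcs, ← Set.range_comp]
        congr 2
        exact funext hwq
      rw [← Submodule.comap_map_mkQ, hmap, Submodule.comap_top]
    · intro x
      set y := ∑ i, x i • φ ((Fin.cons v w : Fin (n + 1) → Λ) i) with hy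
      have hy' : y = x 0 • φ v + ∑ i : Fin n, x i.succ • φ (w i) := by
        rw [hy, Fin.sum_univ_succ]; simp
      have hπy : (ℝ ∙ φ v)ᗮ.starProjection y = ∑ i : Fin n, x i.succ • φ' (c i) := by
        have e0 : (ℝ ∙ φ v)ᗮ.starProjection (φ v) = 0 := hπv
        rw [hy', map_add, map_smul, e0, smul_zero, zero_add, map_sum]
        refine Finset.sum_congr rfl fun i _ => ?_
        rw [map_smul, ← hwq i]
        rfl
      have hπy' : ‖∑ i : Fin n, x i.succ • φ' (c i)‖ ≤ ‖y‖ := by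
        rw [← hπy]; exact Submodule.norm_starProjection_apply_le _ _
      have hsucc : ∀ i : Fin n, l * |x i.succ| ≤ 2 * C * ‖y‖ := by
        intro i
        have h1 := hc (fun i => x i.succ) i
        have h2 := mul_le_mul_of_nonneg_left hπy' hC.le
        linarith
      have hzero : l * |x 0| ≤ (1 + n * C) * ‖y‖ := by
        have hvpos : 0 < ‖φ v‖ := by linarith
        -- Pairing `y` with φ v isolates `x 0`. Size reduction makes each cross term at most half of
        -- ‖φ v‖² times a coordinate that is already bounded.
        have e : inner ℝ (φ v) y =
            x 0 * ‖φ v‖ ^ 2 + ∑ i : Fin n, x i.succ * inner ℝ (φ v) (φ (w i)) := by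
          rw [hy', inner_add_right, inner_smul_right, real_inner_self_eq_norm_sq, inner_sum]
          simp only [inner_smul_right]
        have h1 : |x 0| * ‖φ v‖ ^ 2 ≤
            ‖φ v‖ * ‖y‖ + ∑ i : Fin n, |x i.succ| * (‖φ v‖ ^ 2 / 2) := by
          have e2 : x 0 * ‖φ v‖ ^ 2 =
            inner ℝ (φ v) y - ∑ i : Fin n, x i.succ * inner ℝ (φ v) (φ (w i)) := by linarith
          calc |x 0| * ‖φ v‖ ^ 2 = |x 0 * ‖φ v‖ ^ 2| := by rw [abs_mul, abs_sq]
            _ ≤ |inner ℝ (φ v) y| + |∑ i : Fin n, x i.succ * inner ℝ (φ v) (φ (w i))| := by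
              rw [e2]; exact abs_sub _ _
            _ ≤ _ := by
              refine add_le_add (abs_real_inner_le_norm _ _)
                ((Finset.abs_sum_le_sum_abs _ _).trans (Finset.sum_le_sum fun i _ => ?_))
              rw [abs_mul]
              exact mul_le_mul_of_nonneg_left (hwi i) (abs_nonneg _)
        have h2 : l * ∑ i : Fin n, |x i.succ| ≤ n * (2 * C * ‖y‖) := by
          rw [Finset.mul_sum]
          refine (Finset.sum_le_sum fun i _ => hsucc i).trans ?_
          simp
        rw [← Finset.sum_mul] at h1
        have h3 : |x 0| * ‖φ v‖ ≤ ‖y‖ + (∑ i : Fin n, |x i.succ|) * (‖φ v‖ / 2) := by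
          refine le_of_mul_le_mul_right ?_ hvpos
          nlinarith
        have h4 : l * |x 0| * ‖φ v‖ ≤ (1 + n * C) * ‖y‖ * ‖φ v‖ := by
          have h5 := mul_le_mul_of_nonneg_left h3 hl.le
          have h6 := mul_le_mul_of_nonneg_right h2 (by positivity : 0 ≤ ‖φ v‖ / 2)
          have h7 := mul_le_mul_of_nonneg_right hlv (norm_nonneg y)
          nlinarith
        exact le_of_mul_le_mul_right h4 hvpos
      intro m
      refine Fin.cases ?_ (fun i => ?_) m
      · refine hzero.trans (mul_le_mul_of_nonneg_right ?_ (norm_nonneg _))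
        nlinarith
      · refine (hsucc i).trans (mul_le_mul_of_nonneg_right ?_ (norm_nonneg _))
        nlinarith [mul_nonneg (Nat.cast_nonneg (α := ℝ) n) hC.le]

/-! ### Gaussian integrals -/

/-- The coordinates are independent under a product measure. -/
theorem lintegral_pi_prod {ι : Type*} [Fintype ι] {E : Type*} [MeasurableSpace E]
    (μ : ι → Measure E) [∀ i, IsProbabilityMeasure (μ i)] (f : ι → E → ℝ≥0∞)
    (hf : ∀ i, Measurable (f i)) :
    ∫⁻ x, ∏ i, f i (x i) ∂(Measure.pi μ) = ∏ i, ∫⁻ x, f i x ∂(μ i) := by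
  have hind : iIndepFun (fun i (x : ι → E) => f i (x i)) (Measure.pi μ) :=
    iIndepFun_pi fun i => (hf i).aemeasurable
  rw [lintegral_prod_eq_prod_lintegral_of_indepFun _ _ hind
    (fun i => (hf i).comp (measurable_pi_apply i))]
  refine Finset.prod_congr rfl fun i _ => ?_
  exact (measurePreserving_eval μ i).lintegral_comp (hf i)

instance isProbabilityMeasure_complexGaussian : IsProbabilityMeasure complexGaussian :=
  Measure.isProbabilityMeasure_map (MeasurableEquiv.measurable _).aemeasurable

instance isProbabilityMeasure_gaussianMatrix (m n : ℕ) :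
    IsProbabilityMeasure (gaussianMatrix m n) := by
  unfold gaussianMatrix; infer_instance

theorem lintegral_gaussianMatrix_prod {m n : ℕ} (f : Fin m → Fin n → ℂ → ℝ≥0∞)
    (hf : ∀ i j, Measurable (f i j)) :
    ∫⁻ Z, ∏ i, ∏ j, f i j (Z i j) ∂(gaussianMatrix m n) =
      ∏ i, ∏ j, ∫⁻ z, f i j z ∂complexGaussian := by
  unfold gaussianMatrix
  rw [lintegral_pi_prod (fun _ : Fin m => Measure.pi fun _ : Fin n => complexGaussian)
    (fun i x => ∏ j, f i j (x j))
    (fun i => Finset.measurable_prod _ fun j _ => (hf i j).comp (measurable_pi_apply j))]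
  exact Finset.prod_congr rfl fun i _ => lintegral_pi_prod _ _ (hf i)

theorem lintegral_complexGaussian_mul {f g : ℝ → ℝ≥0∞} (hf : Measurable f) (hg : Measurable g) :
    ∫⁻ z, f z.re * g z.im ∂complexGaussian =
      (∫⁻ x, f x ∂(gaussianReal 0 (1 / 2))) * ∫⁻ x, g x ∂(gaussianReal 0 (1 / 2)) := by
  unfold complexGaussian
  rw [lintegral_map_equiv, ← lintegral_prod_mul hf.aemeasurable hg.aemeasurable]
  rfl

theorem lintegral_exp_mul_gaussianReal (a : ℝ) :
    ∫⁻ x, ENNReal.ofReal (Real.exp (a * x)) ∂(gaussianReal 0 (1 / 2)) =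
      ENNReal.ofReal (Real.exp (a ^ 2 / 4)) := by
  rw [← ofReal_integral_eq_lintegral_ofReal (integrable_exp_mul_gaussianReal a)
    (ae_of_all _ fun x => (Real.exp_pos _).le)]
  have h := congrFun (mgf_fun_id_gaussianReal (μ := 0) (v := 1 / 2)) a
  simp only [mgf] at h
  rw [h]
  congr 2
  push_cast
  ring

theorem lintegral_exp_neg_mul_sq_gaussianReal {t : ℝ} (ht : 0 ≤ t) :
    ∫⁻ x, ENNReal.ofReal (Real.exp (-t * x ^ 2)) ∂(gaussianReal 0 (1 / 2)) =
      ENNReal.ofReal (√(1 / (1 + t))) := by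
  have hint : Integrable (fun x : ℝ => Real.exp (-t * x ^ 2)) (gaussianReal 0 (1 / 2)) := by
    refine Integrable.of_bound (C := 1) (by fun_prop) (ae_of_all _ fun x => ?_)
    rw [Real.norm_eq_abs, abs_of_pos (Real.exp_pos _), Real.exp_le_one_iff]
    nlinarith [sq_nonneg x]
  rw [← ofReal_integral_eq_lintegral_ofReal hint (ae_of_all _ fun x => (Real.exp_pos _).le),
    integral_gaussianReal_eq_integral_smul (by norm_num)]
  congr 1
  -- For variance 1/2 the density is exp(-x²)/√π, so the integrand is again an unnormalized
  -- Gaussian.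
  have e : ∀ x : ℝ, gaussianPDFReal 0 (1 / 2) x • Real.exp (-t * x ^ 2) =
      (√Real.pi)⁻¹ * Real.exp (-(1 + t) * x ^ 2) := by
    intro x
    rw [gaussianPDFReal_def, smul_eq_mul, mul_assoc, ← Real.exp_add]
    push_cast
    congr 2
    · ring_nf
    · ring
  simp_rw [e]
  rw [integral_const_mul, integral_gaussian, Real.sqrt_div Real.pi_pos.le, Real.sqrt_div zero_le_one,
    Real.sqrt_one]
  have := Real.sqrt_pos.mpr Real.pi_pos
  field_simp

theorem lintegral_exp_linear_complexGaussian (a b : ℝ) :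
    ∫⁻ z, ENNReal.ofReal (Real.exp (a * z.re + b * z.im)) ∂complexGaussian =
      ENNReal.ofReal (Real.exp ((a ^ 2 + b ^ 2) / 4)) := by
  have := lintegral_complexGaussian_mul
    (f := fun x => ENNReal.ofReal (Real.exp (a * x)))
    (g := fun x => ENNReal.ofReal (Real.exp (b * x))) (by fun_prop) (by fun_prop)
  rw [lintegral_exp_mul_gaussianReal, lintegral_exp_mul_gaussianReal,
    ← ENNReal.ofReal_mul (Real.exp_pos _).le, ← Real.exp_add] at this
  rw [add_div, ← this]
  refine lintegral_congr fun z => ?_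
  rw [← ENNReal.ofReal_mul (Real.exp_pos _).le, ← Real.exp_add]

/-- The real and imaginary parts each contribute (1 + t)^(-1/2): the squared modulus is exponential
with mean 1. -/
theorem lintegral_exp_neg_normSq_complexGaussian {t : ℝ} (ht : 0 ≤ t) :
    ∫⁻ z, ENNReal.ofReal (Real.exp (-t * ‖z‖ ^ 2)) ∂complexGaussian =
      ENNReal.ofReal (1 / (1 + t)) := by
  have := lintegral_complexGaussian_mul
    (f := fun x => ENNReal.ofReal (Real.exp (-t * x ^ 2)))
    (g := fun x => ENNReal.ofReal (Real.exp (-t * x ^ 2))) (by fun_prop) (by fun_prop)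
  rw [lintegral_exp_neg_mul_sq_gaussianReal ht, ← ENNReal.ofReal_mul (Real.sqrt_nonneg _),
    Real.mul_self_sqrt (by positivity)] at this
  rw [← this]
  refine lintegral_congr fun z => ?_
  rw [← ENNReal.ofReal_mul (Real.exp_pos _).le, ← Real.exp_add, Complex.sq_norm,
    Complex.normSq_apply]
  congr 2
  ring

/-- The Laplace transform of the squared Frobenius norm of a Gaussian matrix. -/
theorem lintegral_exp_neg_frobenius {m n : ℕ} {t : ℝ} (ht : 0 ≤ t) :
    ∫⁻ H, ENNReal.ofReal (Real.exp (-t * ∑ i, ∑ j, ‖H i j‖ ^ 2)) ∂(gaussianMatrix m n) =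
      ENNReal.ofReal ((1 / (1 + t)) ^ (m * n)) := by
  have h := lintegral_gaussianMatrix_prod (m := m) (n := n)
    (fun _ _ z => ENNReal.ofReal (Real.exp (-t * ‖z‖ ^ 2))) (fun _ _ => by fun_prop)
  simp only [lintegral_exp_neg_normSq_complexGaussian ht, Finset.prod_const, Finset.card_univ,
    Fintype.card_fin] at h
  rw [← pow_mul, mul_comm n m, ← ENNReal.ofReal_pow (by positivity)] at h
  rw [← h]
  refine lintegral_congr fun H => ?_
  simp only [Finset.mul_sum, Real.exp_sum]
  rw [ENNReal.ofReal_prod_of_nonneg fun i _ => Finset.prod_nonneg fun j _ => (Real.exp_pos _).le]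
  exact Finset.prod_congr rfl fun i _ =>
    ENNReal.ofReal_prod_of_nonneg fun j _ => (Real.exp_pos _).le

theorem sum_mul_vecReal {n T : ℕ} (b : RIdx n T → ℝ) (Z : Matrix (Fin n) (Fin T) ℂ) :
    ∑ i, b i * vecReal Z i =
      ∑ j, ∑ t, (b (Sum.inl j, t) * (Z j t).re + b (Sum.inr j, t) * (Z j t).im) := by
  simp only [Fintype.sum_prod_type, Fintype.sum_sum_type, Finset.sum_add_distrib]
  rfl

/-- The moment generating function of a linear functional of a Gaussian matrix. -/
theorem lintegral_exp_sum_mul_vecReal {n T : ℕ} (b : RIdx n T → ℝ) :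
    ∫⁻ Z, ENNReal.ofReal (Real.exp (∑ i, b i * vecReal (Matrix.of Z) i)) ∂(gaussianMatrix n T) =
      ENNReal.ofReal (Real.exp ((∑ i, b i ^ 2) / 4)) := by
  have h := lintegral_gaussianMatrix_prod (m := n) (n := T)
    (fun j t z => ENNReal.ofReal
      (Real.exp (b (Sum.inl j, t) * z.re + b (Sum.inr j, t) * z.im)))
    (fun _ _ => by fun_prop)
  have hprod : ∀ g : Fin n → Fin T → ℝ,
      ∏ j, ∏ t, ENNReal.ofReal (Real.exp (g j t)) =
        ENNReal.ofReal (Real.exp (∑ j, ∑ t, g j t)) := by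
    intro g
    simp only [Real.exp_sum]
    rw [ENNReal.ofReal_prod_of_nonneg fun i _ => Finset.prod_nonneg fun j _ => (Real.exp_pos _).le]
    exact Finset.prod_congr rfl fun i _ =>
      (ENNReal.ofReal_prod_of_nonneg fun j _ => (Real.exp_pos _).le).symm
  simp only [lintegral_exp_linear_complexGaussian, hprod] at h
  simp only [sum_mul_vecReal, Matrix.of_apply]
  rw [h]
  congr 2
  simp only [← Finset.sum_div, Fintype.sum_prod_type, Fintype.sum_sum_type, Finset.sum_add_distrib]

theorem measurable_sum_mul_vecReal {n T : ℕ} (b : RIdx n T → ℝ) :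
    Measurable fun Z : Fin n → Fin T → ℂ => ∑ i, b i * vecReal (Matrix.of Z) i := by
  simp only [sum_mul_vecReal, Matrix.of_apply]
  fun_prop

/-- The Chernoff bound for a linear functional of a Gaussian matrix. -/
theorem gaussianMatrix_le_sum_mul_vecReal {n T : ℕ} (b : RIdx n T → ℝ) {v t : ℝ} (hv : 0 < v)
    (ht : 0 ≤ t) (hb : ∑ i, b i ^ 2 ≤ 2 * v) :
    gaussianMatrix n T {Z | t ≤ ∑ i, b i * vecReal (Matrix.of Z) i} ≤
      ENNReal.ofReal (Real.exp (-(t ^ 2 / (2 * v)))) := by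
  -- The tilt t/v minimizes λ²v/2 - λt over λ, the Chernoff exponent for variance v.
  have hm := measurable_sum_mul_vecReal (fun i => t / v * b i)
  have h1 : gaussianMatrix n T {Z | t ≤ ∑ i, b i * vecReal (Matrix.of Z) i} ≤
      gaussianMatrix n T {Z | ENNReal.ofReal (Real.exp (t ^ 2 / v)) ≤
        ENNReal.ofReal (Real.exp (∑ i, (t / v * b i) * vecReal (Matrix.of Z) i))} := by
    refine measure_mono fun Z (hZ : t ≤ _) => ENNReal.ofReal_le_ofReal (Real.exp_le_exp.mpr ?_)
    simp only [mul_assoc, ← Finset.mul_sum]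
    have := mul_le_mul_of_nonneg_left hZ (by positivity : 0 ≤ t / v)
    calc t ^ 2 / v = t / v * t := by ring
      _ ≤ _ := this
  have h2 := meas_ge_le_lintegral_div (μ := gaussianMatrix n T)
    (f := fun Z => ENNReal.ofReal
      (Real.exp (∑ i, (t / v * b i) * vecReal (Matrix.of Z) i)))
    (Real.measurable_exp.comp hm).ennreal_ofReal.aemeasurable
    (ε := ENNReal.ofReal (Real.exp (t ^ 2 / v)))
    (by simp [Real.exp_pos]) ENNReal.ofReal_ne_top
  refine (h1.trans h2).trans ?_
  rw [lintegral_exp_sum_mul_vecReal, ← ENNReal.ofReal_div_of_pos (Real.exp_pos _), ← Real.exp_sub]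
  refine ENNReal.ofReal_le_ofReal (Real.exp_le_exp.mpr ?_)
  simp only [mul_pow, ← Finset.mul_sum]
  have h3 := mul_le_mul_of_nonneg_left hb (by positivity : 0 ≤ (t / v) ^ 2)
  have e : (t / v) ^ 2 * (2 * v) / 4 - t ^ 2 / v = -(t ^ 2 / (2 * v)) := by field_simp; ring
  linarith

/-! ### The real linear model -/

theorem codeMatrix_mulVec {nt T K : ℕ} (D : Fin (2 * K) → Matrix (Fin nt) (Fin T) ℂ)
    (x : Fin (2 * K) → ℝ) : codeMatrix D *ᵥ x = vecReal (codeword D x) := by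
  funext i
  obtain ⟨j | j, t⟩ := i <;>
  simp [codeMatrix, vecReal, codeword, Matrix.mulVec, dotProduct, Matrix.sum_apply, mul_comm]

theorem realChannel_kronecker_mulVec {nr nt T : ℕ} (H : Matrix (Fin nr) (Fin nt) ℂ)
    (X : Matrix (Fin nt) (Fin T) ℂ) :
    (realChannel H ⊗ₖ (1 : Matrix (Fin T) (Fin T) ℝ)) *ᵥ vecReal X = vecReal (H * X) := by
  funext i
  obtain ⟨j | j, t⟩ := i <;>
  simp [realChannel, vecReal, Matrix.mulVec, dotProduct, Matrix.mul_apply, Fintype.sum_prod_type,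
    Matrix.one_apply, Finset.sum_add_distrib, sub_eq_add_neg, add_comm]

theorem effChannel_mulVec {nr nt T K : ℕ} (D : Fin (2 * K) → Matrix (Fin nt) (Fin T) ℂ)
    (H : Matrix (Fin nr) (Fin nt) ℂ) (x : Fin (2 * K) → ℝ) :
    effChannel D H *ᵥ x = vecReal (H * codeword D x) := by
  rw [effChannel, ← Matrix.mulVec_mulVec, codeMatrix_mulVec, realChannel_kronecker_mulVec]

/-- The normalization cancels the transmit power, which leaves `P` only in the scale of the noise.
-/
theorem receivedVec_eq {nr nt T K : ℕ} (hnt : 0 < nt)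
    (D : Fin (2 * K) → Matrix (Fin nt) (Fin T) ℂ) {P : ℝ} (hP : 0 < P)
    (H : Matrix (Fin nr) (Fin nt) ℂ) (x : Fin (2 * K) → ℝ) (Z : Matrix (Fin nr) (Fin T) ℂ) :
    receivedVec D P H x Z = effChannel D H *ᵥ x + √(nt / P) • vecReal Z := by
  have hnt' : (0 : ℝ) < nt := Nat.cast_pos.mpr hnt
  have e : √(nt / P) * √(P / nt) = 1 := by
    rw [← Real.sqrt_mul (by positivity)]
    have : (nt : ℝ) / P * (P / nt) = 1 := by field_simp
    rw [this, Real.sqrt_one]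
  rw [effChannel_mulVec]
  funext i
  obtain ⟨j | j, t⟩ := i <;>
  simp only [receivedVec, received, vecReal, Pi.smul_apply, Pi.add_apply, Matrix.add_apply,
      Matrix.smul_apply, smul_eq_mul, Complex.add_re, Complex.add_im, Complex.re_ofReal_mul,
      Complex.im_ofReal_mul, mul_add, ← mul_assoc, e, one_mul]

/-- The quantizer input is the integer combination `A s` plus the quantization noise plus the
filtered channel noise. -/
theorem filtered_apply {nr nt T K : ℕ} (hnt : 0 < nt)
    (D : Fin (2 * K) → Matrix (Fin nt) (Fin T) ℂ) {P : ℝ} (hP : 0 < P) (τ : ℝ)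
    (r : Receiver nr T K) (H : Matrix (Fin nr) (Fin nt) ℂ) (s : Fin (2 * K) → ℤ)
    (Z : Matrix (Fin nr) (Fin T) ℂ) (m : Fin (2 * K)) :
    filtered D P τ r H s Z m = (((r.A *ᵥ s) m : ℤ) : ℝ) +
      ∑ k, ((r.B m ᵥ* effChannel D H) k - r.A m k) * (s k - τ) +
      ∑ i, (√(nt / P) * r.B m i) * vecReal Z i := by
  have e1 : (r.B *ᵥ (effChannel D H *ᵥ fun k => (s k : ℝ) - τ)) m =
      ∑ k, (r.B m ᵥ* effChannel D H) k * (s k - τ) := by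
    change r.B m ⬝ᵥ (effChannel D H *ᵥ fun k => (s k : ℝ) - τ) = _
    rw [Matrix.dotProduct_mulVec]
    rfl
  have e2 : (r.B *ᵥ (√(nt / P) • vecReal Z)) m =
      ∑ i, (√(nt / P) * r.B m i) * vecReal Z i := by
    simp only [Matrix.mulVec, dotProduct, Pi.smul_apply, smul_eq_mul]
    exact Finset.sum_congr rfl fun i _ => by ring
  rw [filtered, receivedVec_eq hnt D hP, Matrix.mulVec_add, Pi.add_apply, Pi.add_apply, e1, e2]
  simp only [Matrix.mulVec, dotProduct, Matrix.map_apply, Int.cast_sum, Int.cast_mul, sub_mul,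
    Finset.sum_sub_distrib, mul_sub]
  ring

/-! ### The minimum singular value and the minimum distance of the received lattice -/

theorem sum_vecReal_sq {n T : ℕ} (Y : Matrix (Fin n) (Fin T) ℂ) :
    ∑ i, vecReal Y i ^ 2 = ∑ j, ∑ t, ‖Y j t‖ ^ 2 := by
  simp only [Complex.sq_norm, Complex.normSq_apply, ← sq]
  simp only [Fintype.sum_prod_type, Fintype.sum_sum_type, Finset.sum_add_distrib, vecReal]

theorem trace_mul_conjTranspose_self {m n : ℕ} (Y : Matrix (Fin m) (Fin n) ℂ) :
    (Y * Yᴴ).trace = ((∑ i, ∑ j, ‖Y i j‖ ^ 2 : ℝ) : ℂ) := by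
  simp only [Matrix.trace, Matrix.diag_apply, Matrix.mul_apply, Matrix.conjTranspose_apply,
    RCLike.star_def, Complex.mul_conj, Complex.normSq_eq_norm_sq, Complex.ofReal_sum]

-- In the eigenvector basis the difference is diagonal with entries λ_j - c ≥ 0.
open scoped ComplexOrder in
theorem posSemidef_sub_smul_one {n : ℕ} {M : Matrix (Fin n) (Fin n) ℂ} (hM : M.IsHermitian)
    {c : ℝ} (hc : ∀ j, c ≤ hM.eigenvalues j) :
    (M - (c : ℂ) • (1 : Matrix (Fin n) (Fin n) ℂ)).PosSemidef := by
  have hU : (hM.eigenvectorUnitary : Matrix (Fin n) (Fin n) ℂ) *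
      (hM.eigenvectorUnitary : Matrix (Fin n) (Fin n) ℂ)ᴴ = 1 :=
    Unitary.coe_mul_star_self hM.eigenvectorUnitary
  have hd : (Matrix.diagonal fun j => ((hM.eigenvalues j - c : ℝ) : ℂ)).PosSemidef :=
    Matrix.PosSemidef.diagonal fun j => by
      simpa using sub_nonneg.mpr (hc j)
  have h := hd.mul_mul_conjTranspose_same (hM.eigenvectorUnitary : Matrix (Fin n) (Fin n) ℂ)
  convert h using 1
  conv_lhs => rw [hM.spectral_theorem, Unitary.conjStarAlgAut_apply]
  have e : (Matrix.diagonal fun j => ((hM.eigenvalues j - c : ℝ) : ℂ)) =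
      Matrix.diagonal (RCLike.ofReal ∘ hM.eigenvalues) - (c : ℂ) • 1 := by
    rw [← Matrix.diagonal_one, ← Matrix.diagonal_smul, Matrix.diagonal_sub]
    congr 1
    funext j
    simp
  rw [e, mul_sub, sub_mul, mul_smul_comm, mul_one, smul_mul_assoc, hU]
  rfl

-- Conjugating X Xᴴ - σ² I by `H` preserves positive semidefiniteness; the trace of the result is
-- the difference of the two sides.
open scoped ComplexOrder in
theorem sq_mul_frobenius_le {nr nt T : ℕ} (H : Matrix (Fin nr) (Fin nt) ℂ)
    (X : Matrix (Fin nt) (Fin T) ℂ) {σ : ℝ} (h0 : 0 ≤ σ) (hσ : σ ≤ sigmaMin X) :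
    σ ^ 2 * ∑ i, ∑ j, ‖H i j‖ ^ 2 ≤ ∑ i, ∑ t, ‖(H * X) i t‖ ^ 2 := by
  have hev : ∀ j, σ ^ 2 ≤ (Matrix.isHermitian_mul_conjTranspose_self X).eigenvalues j := by
    intro j
    have h1 : σ ≤ singularValue X j := hσ.trans (ciInf_le (Set.finite_range _).bddBelow j)
    have h2 := Matrix.eigenvalues_self_mul_conjTranspose_nonneg X j
    calc σ ^ 2 ≤ singularValue X j ^ 2 := pow_le_pow_left₀ h0 h1 2
      _ = _ := Real.sq_sqrt h2
  have h := ((posSemidef_sub_smul_one _ hev).mul_mul_conjTranspose_same H).trace_nonneg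
  rw [Matrix.mul_sub, Matrix.sub_mul, Matrix.mul_smul, Matrix.mul_one, Matrix.smul_mul,
    Matrix.trace_sub, Matrix.trace_smul, trace_mul_conjTranspose_self H, ← Matrix.mul_assoc,
    Matrix.mul_assoc (H * X),
    ← Matrix.conjTranspose_mul, trace_mul_conjTranspose_self, smul_eq_mul, sub_nonneg] at h
  exact_mod_cast h

theorem codeSigmaMin_nonneg {nt T : ℕ} (C : Set (Matrix (Fin nt) (Fin T) ℂ)) :
    0 ≤ codeSigmaMin C := by
  refine Real.sInf_nonneg ?_
  rintro _ ⟨X, -, rfl⟩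
  exact Real.iInf_nonneg fun j => Real.sqrt_nonneg _

theorem codeSigmaMin_le {nt T : ℕ} {C : Set (Matrix (Fin nt) (Fin T) ℂ)}
    {X : Matrix (Fin nt) (Fin T) ℂ} (hX : X ∈ C) (h0 : X ≠ 0) : codeSigmaMin C ≤ sigmaMin X := by
  refine csInf_le ⟨0, ?_⟩ ⟨X, ⟨hX, h0⟩, rfl⟩
  rintro _ ⟨X, -, rfl⟩
  exact Real.iInf_nonneg fun j => Real.sqrt_nonneg _

theorem codeword_intCast_ne_zero {nt T K : ℕ} {D : Fin (2 * K) → Matrix (Fin nt) (Fin T) ℂ}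
    (hD : LinearIndependent ℤ D) {d : Fin (2 * K) → ℤ} (hd : d ≠ 0) :
    codeword D (fun k => (d k : ℝ)) ≠ 0 := by
  intro h
  refine hd (funext (Fintype.linearIndependent_iff.mp hD d ?_))
  rw [← h, codeword]
  refine Finset.sum_congr rfl fun k _ => ?_
  rw [Complex.ofReal_intCast, Int.cast_smul_eq_zsmul]

/-- The squared minimum distance of the received lattice is at least the squared minimum singular
value of the code times the squared Frobenius norm of the channel. -/
theorem sq_mul_frobenius_le_effChannel {nr nt T K : ℕ}
    {D : Fin (2 * K) → Matrix (Fin nt) (Fin T) ℂ} (hD : LinearIndependent ℤ D)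
    (H : Matrix (Fin nr) (Fin nt) ℂ) {d : Fin (2 * K) → ℤ} (hd : d ≠ 0) :
    codeSigmaMin (infiniteCode D) ^ 2 * ∑ i, ∑ j, ‖H i j‖ ^ 2 ≤
      ∑ i, (effChannel D H *ᵥ fun k => (d k : ℝ)) i ^ 2 := by
  rw [effChannel_mulVec, sum_vecReal_sq]
  exact sq_mul_frobenius_le H _ (codeSigmaMin_nonneg _)
    (codeSigmaMin_le ⟨d, rfl⟩ (codeword_intCast_ne_zero hD hd))

/-! ### The noise power of the optimal receiver -/

/-- For a channel whose received lattice has minimum distance at least `l`, there is a unimodular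
integer matrix whose rows `a` satisfy `|a x| ≤ C / l * ‖G x‖`. -/
theorem exists_unimodular_abs_mulVec_le (n : ℕ) :
    ∃ C : ℝ, 0 < C ∧ ∀ (ι : Type) [Fintype ι] (G : Matrix ι (Fin n) ℝ) (l : ℝ), 0 < l →
      (∀ d : Fin n → ℤ, d ≠ 0 → l ^ 2 ≤ ∑ i, (G *ᵥ fun k => (d k : ℝ)) i ^ 2) →
      ∃ A : Matrix (Fin n) (Fin n) ℤ, IsUnit A ∧ ∀ (x : Fin n → ℝ) (m : Fin n),
        l * |(A.map (Int.cast : ℤ → ℝ) *ᵥ x) m| ≤ C * √(∑ i, (G *ᵥ x) i ^ 2) := by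
  obtain ⟨C, hC, h⟩ := exists_basis_coord_le n
  refine ⟨C, hC, fun ι _ G l hl hd => ?_⟩
  let φ : (Fin n → ℤ) →ₗ[ℤ] EuclideanSpace ℝ ι :=
    { toFun := fun d => WithLp.toLp 2 (G *ᵥ fun k => (d k : ℝ))
      map_add' := fun d e => by
        rw [← WithLp.toLp_add, ← Matrix.mulVec_add]
        congr 2
        funext k
        simp
      map_smul' := fun a d => by
        rw [RingHom.id_apply, ← Int.cast_smul_eq_zsmul ℝ a (WithLp.toLp 2 _),
          ← WithLp.toLp_smul, ← Matrix.mulVec_smul]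
        congr 2
        funext k
        simp }
  have hφ : ∀ d, ‖φ d‖ = √(∑ i, (G *ᵥ fun k => (d k : ℝ)) i ^ 2) := fun d => by
    simp [φ, EuclideanSpace.norm_eq]
  obtain ⟨c, hcs, hc⟩ := h (Fin n → ℤ) (EuclideanSpace ℝ ι) φ l (by simp) hl
    (fun d h0 => by rw [hφ]; exact Real.le_sqrt_of_sq_le (hd d h0))
  -- The coordinates of the unit vectors in the basis `c` form the columns of `A`. Thus `A` inverts
  -- the basis matrix, and A x lists the coordinates of G x in the basis φ(c i).
  have hmem : ∀ j : Fin n, ∃ a : Fin n → ℤ, ∑ i, a i • c i = Pi.single j 1 := fun j =>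
    (Submodule.mem_span_range_iff_exists_fun ℤ).mp (hcs ▸ Submodule.mem_top)
  choose a ha using hmem
  let A : Matrix (Fin n) (Fin n) ℤ := Matrix.of fun i j => a j i
  have hmul : (Matrix.of fun k i => c i k) * A = 1 := by
    ext k j
    have := congrFun (ha j) k
    simp only [Finset.sum_apply, Pi.smul_apply, smul_eq_mul, Pi.single_apply] at this
    rw [Matrix.one_apply, ← this, Matrix.mul_apply]
    exact Finset.sum_congr rfl fun i _ => mul_comm _ _
  refine ⟨A, ⟨⟨A, _, mul_eq_one_comm.mp hmul, hmul⟩, rfl⟩, fun x m => ?_⟩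
  have hGx : ∑ i, (A.map (Int.cast : ℤ → ℝ) *ᵥ x) i • φ (c i) = WithLp.toLp 2 (G *ᵥ x) := by
    have e : ∀ i, (A.map (Int.cast : ℤ → ℝ) *ᵥ x) i • φ (c i) =
        WithLp.toLp 2 (G *ᵥ ((A.map (Int.cast : ℤ → ℝ) *ᵥ x) i • fun k => (c i k : ℝ))) := by
      intro i
      rw [Matrix.mulVec_smul, WithLp.toLp_smul]
      rfl
    rw [Finset.sum_congr rfl fun i _ => e i, ← WithLp.toLp_sum, ← Matrix.mulVec_sum]
    congr 2
    have hmul' : (Matrix.of fun k i => (c i k : ℝ)) * A.map (Int.cast : ℤ → ℝ) = 1 := by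
      have := congrArg (fun M : Matrix (Fin n) (Fin n) ℤ => M.map (Int.castRingHom ℝ)) hmul
      simp only [Matrix.map_mul, Matrix.map_one _ (map_zero (Int.castRingHom ℝ))
        (map_one (Int.castRingHom ℝ))] at this
      exact this
    conv_rhs => rw [← Matrix.one_mulVec x, ← hmul', ← Matrix.mulVec_mulVec]
    funext k
    simp only [Finset.sum_apply, Pi.smul_apply, smul_eq_mul]
    exact Finset.sum_congr rfl fun i _ => mul_comm _ _
  have := hc (A.map (Int.cast : ℤ → ℝ) *ᵥ x) m
  rw [hGx, EuclideanSpace.norm_eq] at this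
  simpa using this

theorem invertibleOver_of_isUnit {K : ℕ} (q : ℕ) {A : Matrix (Fin (2 * K)) (Fin (2 * K)) ℤ}
    (hA : IsUnit A) : InvertibleOver q A :=
  hA.map (Int.castRingHom (ZMod q)).mapMatrix

/-- A kernel vector x of GᵀG satisfies ‖Gx‖² = xᵀGᵀGx = 0. -/
theorem isUnit_transpose_mul_self {ι : Type*} [Fintype ι] {n : ℕ} {G : Matrix ι (Fin n) ℝ}
    (hG : ∀ x, G *ᵥ x = 0 → x = 0) : IsUnit (Gᵀ * G).det := by
  rw [isUnit_iff_ne_zero]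
  intro h
  obtain ⟨x, hx, h0⟩ := Matrix.exists_mulVec_eq_zero_iff.mpr h
  refine hx (hG x ?_)
  have : (G *ᵥ x) ⬝ᵥ (G *ᵥ x) = 0 := by
    rw [Matrix.dotProduct_mulVec, ← Matrix.mulVec_transpose, Matrix.mulVec_mulVec, h0,
      zero_dotProduct]
  exact dotProduct_self_eq_zero.mp this

theorem pinv_mul_self {nr T K : ℕ} {G : Matrix (RIdx nr T) (Fin (2 * K)) ℝ}
    (hG : IsUnit (Gᵀ * G).det) : pinv G * G = 1 := by
  rw [pinv, Matrix.mul_assoc, Matrix.nonsing_inv_mul _ hG]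

/-- A row vector `a` with `|a x| ≤ c ‖G x‖` for all `x` has `‖a G⁺‖ ≤ c`. -/
theorem sum_vecMul_pinv_sq_le {nr T K : ℕ} {G : Matrix (RIdx nr T) (Fin (2 * K)) ℝ}
    (hG : IsUnit (Gᵀ * G).det) (a : Fin (2 * K) → ℝ) {c : ℝ} (hc : 0 ≤ c)
    (h : ∀ x, |a ⬝ᵥ x| ≤ c * √(∑ i, (G *ᵥ x) i ^ 2)) :
    ∑ i, (a ᵥ* pinv G) i ^ 2 ≤ c ^ 2 := by
  set S := ∑ i, (a ᵥ* pinv G) i ^ 2 with hS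
  have hS0 : 0 ≤ S := Finset.sum_nonneg fun i _ => sq_nonneg _
  have hsymm : ((Gᵀ * G)⁻¹)ᵀ = (Gᵀ * G)⁻¹ := by
    rw [Matrix.transpose_nonsing_inv, Matrix.transpose_mul, Matrix.transpose_transpose]
  have e1 : G *ᵥ ((Gᵀ * G)⁻¹ *ᵥ a) = a ᵥ* pinv G := by
    rw [pinv, ← Matrix.vecMul_vecMul, Matrix.vecMul_transpose, ← Matrix.mulVec_transpose, hsymm]
  have e2 : S ≤ |a ⬝ᵥ ((Gᵀ * G)⁻¹ *ᵥ a)| := by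
    have : S = (a ᵥ* pinv G) ⬝ᵥ (G *ᵥ ((Gᵀ * G)⁻¹ *ᵥ a)) := by
      rw [e1, hS, dotProduct]
      exact Finset.sum_congr rfl fun i _ => sq _
    rw [this, Matrix.dotProduct_mulVec, Matrix.vecMul_vecMul, pinv_mul_self hG, Matrix.vecMul_one]
    exact le_abs_self _
  -- At x = (GᵀG)⁻¹a the image G x is a G⁺ itself and a · x = ‖a G⁺‖² = S, so the hypothesis becomes
  -- S ≤ c √S.
  have h1 := h ((Gᵀ * G)⁻¹ *ᵥ a)
  rw [e1] at h1
  have h2 : S ≤ c * √S := e2.trans h1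
  have h3 : √S ≤ c := by
    by_contra hlt
    push Not at hlt
    have hp : 0 < √S := hc.trans_lt hlt
    have := mul_lt_mul_of_pos_right hlt hp
    rw [Real.mul_self_sqrt hS0] at this
    linarith
  calc S = √S ^ 2 := (Real.sq_sqrt hS0).symm
    _ ≤ c ^ 2 := pow_le_pow_left₀ (Real.sqrt_nonneg _) h3 2

/-- The largest noise power of either form of the optimal receiver is at most
`nt / (2 P) * (C / l) ^ 2`, where `l` is the minimum distance of the received lattice. -/
theorem exists_noisePower_le (K : ℕ) :
    ∃ C : ℝ, 0 < C ∧ ∀ {nr T : ℕ} (nt q : ℕ) (G : Matrix (RIdx nr T) (Fin (2 * K)) ℝ) (E P l : ℝ)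
      (r : Receiver nr T K), 0 < P → 0 < l →
      (∀ d : Fin (2 * K) → ℤ, d ≠ 0 → l ^ 2 ≤ ∑ i, (G *ᵥ fun k => (d k : ℝ)) i ^ 2) →
      IsOptimal nt q G E P r ∨ IsHighSNROptimal q G r →
      ∀ m, noisePower nt G E P (r.A m) (r.B m) ≤ nt / (2 * P) * (C / l) ^ 2 := by
  obtain ⟨C, hC, h⟩ := exists_unimodular_abs_mulVec_le (2 * K)
  refine ⟨C, hC, fun {nr T} nt q G E P l r hP hl hd hr m => ?_⟩
  obtain ⟨A, hA, hAx⟩ := h (RIdx nr T) G l hl hd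
  -- The distance hypothesis concerns integer vectors only. Injectivity over ℝ comes from the bound
  -- on A x: G x = 0 forces A x = 0, and `A` is invertible.
  have hG : IsUnit (Gᵀ * G).det := isUnit_transpose_mul_self fun x hx => by
    have h0 : A.map (Int.cast : ℤ → ℝ) *ᵥ x = 0 := by
      funext m
      have := hAx x m
      simp only [hx, Pi.zero_apply, ne_eq, OfNat.ofNat_ne_zero, not_false_eq_true, zero_pow,
        Finset.sum_const_zero, Real.sqrt_zero, mul_zero] at this
      exact abs_nonpos_iff.mp (nonpos_of_mul_nonpos_right this hl)
    have hu : IsUnit (A.map (Int.cast : ℤ → ℝ)) := hA.map (Int.castRingHom ℝ).mapMatrix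
    exact Matrix.mulVec_injective_of_isUnit hu (by rw [h0, Matrix.mulVec_zero])
  have hrow : ∀ (M : Matrix (Fin (2 * K)) (Fin (2 * K)) ℤ) (m : Fin (2 * K)),
      (M.map (Int.cast : ℤ → ℝ) * pinv G) m = (fun k => (M m k : ℝ)) ᵥ* pinv G := fun M m => rfl
  have hzero : ∀ (M : Matrix (Fin (2 * K)) (Fin (2 * K)) ℤ) (m : Fin (2 * K)),
      noisePower nt G E P (M m) ((M.map (Int.cast : ℤ → ℝ) * pinv G) m) =
        nt / (2 * P) * ∑ i, (M.map (Int.cast : ℤ → ℝ) * pinv G) m i ^ 2 := by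
    intro M m
    rw [noisePower, hrow, Matrix.vecMul_vecMul, pinv_mul_self hG, Matrix.vecMul_one]
    simp
  have hshort : ∀ m, ∑ i, (A.map (Int.cast : ℤ → ℝ) * pinv G) m i ^ 2 ≤ (C / l) ^ 2 := by
    intro m
    rw [hrow]
    refine sum_vecMul_pinv_sq_le hG _ (by positivity) fun x => ?_
    have := hAx x m
    rw [div_mul_eq_mul_div, le_div_iff₀ hl, mul_comm]
    exact this
  have hAq := invertibleOver_of_isUnit q hA
  have hcoef : (0 : ℝ) ≤ nt / (2 * P) := by positivity
  rcases hr with ⟨-, hopt⟩ | ⟨-, hB, hopt⟩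
  · obtain ⟨m', hm'⟩ := hopt ⟨A, A.map (Int.cast : ℤ → ℝ) * pinv G⟩ hAq m
    refine hm'.trans ?_
    rw [hzero]
    exact mul_le_mul_of_nonneg_left (hshort m') hcoef
  · obtain ⟨m', hm'⟩ := hopt A hAq m
    have := hzero r.A m
    rw [← hB] at this
    rw [this]
    exact mul_le_mul_of_nonneg_left (hm'.trans (hshort m')) hcoef

/-! ### The energy of the constellation -/

theorem sum_constellation (q : ℕ) (f : ℤ → ℝ) :
    ∑ x ∈ constellation q, f x = ∑ i ∈ Finset.range q, f i := by
  refine (Finset.sum_nbij (fun i : ℕ => (i : ℤ)) ?_ ?_ ?_ fun _ _ => rfl).symm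
  · intro i hi
    simpa [constellation] using hi
  · exact Nat.cast_injective.injOn
  · intro x hx
    simp only [constellation, Finset.coe_Ico, Set.mem_Ico] at hx
    exact ⟨x.toNat, by simp; omega, by simp [hx.1]⟩

/-- Every point of the shifted constellation has at most six times the average energy. -/
theorem sq_sub_le_avgEnergy {q : ℕ} {x : ℤ} (hx : x ∈ constellation q) (τ : ℝ) :
    ((x : ℝ) - τ) ^ 2 ≤ 6 * avgEnergy q τ := by
  simp only [constellation, Finset.mem_Ico] at hx
  have hq : 0 < q := by omega
  have hq' : (1 : ℝ) ≤ q := by exact_mod_cast hq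
  have hsum : ∀ n : ℕ, ∑ i ∈ Finset.range n, (((i : ℤ) : ℝ) - τ) ^ 2 =
      n * ((n - 1) * (2 * n - 1) / 6 - (n - 1) * τ + τ ^ 2) := by
    intro n
    induction n with
    | zero => simp
    | succ n ih => rw [Finset.sum_range_succ, ih]; push_cast; ring
  rw [avgEnergy, sum_constellation, hsum, mul_div_cancel_left₀ _ (by positivity)]
  have h0 : (0 : ℝ) ≤ x := by exact_mod_cast hx.1
  have h1 : (x : ℝ) ≤ q - 1 := by
    have : x ≤ (q : ℤ) - 1 := by omega
    exact_mod_cast this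
  -- With L = q - 1, the difference of the two sides equals (x + τ - L)² + (2τ - L)² + 2x(L - x) +
  -- L.
  nlinarith [sq_nonneg ((x : ℝ) + τ - (q - 1)), mul_nonneg h0 (sub_nonneg.mpr h1),
    sq_nonneg (2 * τ - (q - 1))]

/-! ### The error probability -/

/-- The squared quantization noise is at most `12 K` times the noise power. -/
theorem sq_quantizationNoise_le {nr T K q : ℕ} {nt : ℕ} {G : Matrix (RIdx nr T) (Fin (2 * K)) ℝ}
    {P τ : ℝ} (hP : 0 < P) {a : Fin (2 * K) → ℤ} {b : RIdx nr T → ℝ} {s : Fin (2 * K) → ℤ}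
    (hs : ∀ i, s i ∈ constellation q) :
    (∑ k, ((b ᵥ* G) k - a k) * (s k - τ)) ^ 2 ≤
      12 * K * noisePower nt G (avgEnergy q τ) P a b := by
  have h1 := Finset.sum_mul_sq_le_sq_mul_sq Finset.univ
    (fun k => (b ᵥ* G) k - (a k : ℝ)) (fun k => (s k : ℝ) - τ)
  have h2 : ∑ k, ((s k : ℝ) - τ) ^ 2 ≤ 12 * K * avgEnergy q τ := by
    refine (Finset.sum_le_sum fun k _ => sq_sub_le_avgEnergy (hs k) τ).trans_eq ?_
    simp only [Finset.sum_const, Finset.card_univ, Fintype.card_fin, nsmul_eq_mul]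
    push_cast
    ring
  have h3 : 0 ≤ ∑ k, ((b ᵥ* G) k - (a k : ℝ)) ^ 2 := Finset.sum_nonneg fun _ _ => sq_nonneg _
  have h4 : 0 ≤ (nt : ℝ) / (2 * P) * ∑ i, b i ^ 2 :=
    mul_nonneg (by positivity) (Finset.sum_nonneg fun _ _ => sq_nonneg _)
  have h5 : (0 : ℝ) ≤ 12 * K := by positivity
  rw [noisePower]
  nlinarith [mul_le_mul_of_nonneg_left h2 h3, mul_nonneg h5 h4]

/-- The conditional error probability, given the channel, of a receiver all of whose layers have
noise power at most `v`. -/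
theorem gaussianMatrix_step1_ne_le {nr nt T K q : ℕ} (hnt : 0 < nt) (hK : 0 < K)
    (D : Fin (2 * K) → Matrix (Fin nt) (Fin T) ℂ) {P : ℝ} (hP : 0 < P) (τ : ℝ)
    (r : Receiver nr T K) (H : Matrix (Fin nr) (Fin nt) ℂ) {s : Fin (2 * K) → ℤ}
    (hs : ∀ i, s i ∈ constellation q) {v : ℝ} (hv : 0 < v)
    (hr : ∀ m, noisePower nt (effChannel D H) (avgEnergy q τ) P (r.A m) (r.B m) ≤ v) :
    gaussianMatrix nr T {Z | step1 D P τ r H s (Matrix.of Z) ≠ r.A *ᵥ s} ≤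
      ENNReal.ofReal ((4 * K + Real.exp (6 * K)) * Real.exp (-(1 / (32 * v)))) := by
  have hK' : (0 : ℝ) < K := Nat.cast_pos.mpr hK
  -- If the quantization noise cannot be bounded by 1/4, then 1/(32v) < 6K, and the term exp(6K)
  -- makes the claimed bound at least 1.
  by_cases hlarge : 1 / 16 < 12 * K * v
  · refine prob_le_one.trans ?_
    rw [← ENNReal.ofReal_one]
    refine ENNReal.ofReal_le_ofReal ?_
    have h1 : 1 / (32 * v) ≤ 6 * K := by
      rw [div_le_iff₀ (by positivity)]
      nlinarith
    calc (1 : ℝ) ≤ Real.exp (6 * K + -(1 / (32 * v))) := Real.one_le_exp (by linarith)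
      _ = Real.exp (6 * K) * Real.exp (-(1 / (32 * v))) := Real.exp_add _ _
      _ ≤ _ := by
        refine mul_le_mul_of_nonneg_right ?_ (Real.exp_pos _).le
        linarith
  push Not at hlarge
  let w : Fin (2 * K) → RIdx nr T → ℝ := fun m i => √(nt / P) * r.B m i
  have hw : ∀ m, ∑ i, w m i ^ 2 ≤ 2 * v := by
    intro m
    have h1 := hr m
    have h2 : 0 ≤ avgEnergy q τ := div_nonneg (Finset.sum_nonneg fun _ _ => sq_nonneg _) (by simp)
    have h3 : 0 ≤ ∑ k, ((r.B m ᵥ* effChannel D H) k - (r.A m k : ℝ)) ^ 2 :=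
      Finset.sum_nonneg fun _ _ => sq_nonneg _
    have h4 : ∑ i, w m i ^ 2 = 2 * (nt / (2 * P) * ∑ i, r.B m i ^ 2) := by
      simp only [w, mul_pow, ← Finset.mul_sum]
      rw [Real.sq_sqrt (by positivity), ← mul_assoc]
      congr 1
      field_simp
    rw [noisePower] at h1
    rw [h4]
    nlinarith [mul_nonneg h3 h2]
  have hw' : ∀ m, ∑ i, (-w m) i ^ 2 ≤ 2 * v := fun m => by simpa using hw m
  -- Quantization noise at most 1/4 and Gaussian noise strictly below 1/4 in modulus keep the total
  -- strictly inside the rounding interval. The 2K layers and two signs give the factor 4K.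
  have hsub : {Z | step1 D P τ r H s (Matrix.of Z) ≠ r.A *ᵥ s} ⊆
      ⋃ m, ({Z | 1 / 4 ≤ ∑ i, w m i * vecReal (Matrix.of Z) i} ∪
        {Z | 1 / 4 ≤ ∑ i, (-w m) i * vecReal (Matrix.of Z) i}) := by
    intro Z hZ
    obtain ⟨m, hm⟩ := Function.ne_iff.mp hZ
    refine Set.mem_iUnion.mpr ⟨m, ?_⟩
    by_contra hcon
    simp only [Set.mem_union, not_or] at hcon
    obtain ⟨hc1, hc2⟩ := hcon
    replace hc1 : ∑ i, w m i * vecReal (Matrix.of Z) i < 1 / 4 := not_le.mp hc1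
    replace hc2 : ∑ i, (-w m) i * vecReal (Matrix.of Z) i < 1 / 4 := not_le.mp hc2
    simp only [Pi.neg_apply, neg_mul, Finset.sum_neg_distrib] at hc2
    refine hm ?_
    have hu := (sq_quantizationNoise_le (nt := nt) (G := effChannel D H) (τ := τ) (a := r.A m)
      (b := r.B m) hP hs).trans
      ((mul_le_mul_of_nonneg_left (hr m) (by positivity)).trans hlarge)
    have hu' := abs_le_of_sq_le_sq' (hu.trans_eq (by norm_num : (1 / 16 : ℝ) = (1 / 4) ^ 2)) (by norm_num)
    have hf := filtered_apply hnt D hP τ r H s (Matrix.of Z) m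
    simp only [step1]
    rw [round_eq, Int.floor_eq_iff]
    simp only [w] at hc1 hc2
    constructor <;> linarith [hu'.1, hu'.2]
  refine (measure_mono hsub).trans ((measure_iUnion_fintype_le _ _).trans ?_)
  have hone : ∀ m, gaussianMatrix nr T ({Z | 1 / 4 ≤ ∑ i, w m i * vecReal (Matrix.of Z) i} ∪
        {Z | 1 / 4 ≤ ∑ i, (-w m) i * vecReal (Matrix.of Z) i}) ≤
      ENNReal.ofReal (2 * Real.exp (-(1 / (32 * v)))) := by
    intro m
    have e : (1 / 4 : ℝ) ^ 2 / (2 * v) = 1 / (32 * v) := by field_simp; norm_num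
    refine (measure_union_le _ _).trans ?_
    rw [two_mul, ENNReal.ofReal_add (Real.exp_pos _).le (Real.exp_pos _).le, ← e]
    exact add_le_add (gaussianMatrix_le_sum_mul_vecReal _ hv (by norm_num) (hw m))
      (gaussianMatrix_le_sum_mul_vecReal _ hv (by norm_num) (hw' m))
  refine (Finset.sum_le_sum fun m _ => hone m).trans ?_
  rw [Finset.sum_const, Finset.card_univ, Fintype.card_fin, nsmul_eq_mul, ← ENNReal.ofReal_natCast,
    ← ENNReal.ofReal_mul (by positivity)]
  refine ENNReal.ofReal_le_ofReal ?_
  push_cast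
  nlinarith [mul_pos (Real.exp_pos (6 * K)) (Real.exp_pos (-(1 / (32 * v))))]

/-- The error probability of either form of the optimal receiver decays like `P ^ (-nt * nr)`. -/
theorem exists_errorProb_le (nt nr T K : ℕ) (hnt : 0 < nt) (hK : 0 < K) :
    ∃ κ C₀ : ℝ, 0 < κ ∧ 0 < C₀ ∧ ∀ D : Fin (2 * K) → Matrix (Fin nt) (Fin T) ℂ,
      LinearIndependent ℤ D → NVS D → ∀ (q : ℕ) (τ P : ℝ), 0 < P →
      ∀ r : Matrix (Fin nr) (Fin nt) ℂ → Receiver nr T K,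
      (∀ H, IsOptimal nt q (effChannel D H) (avgEnergy q τ) P (r H) ∨
        IsHighSNROptimal q (effChannel D H) (r H)) →
      ∀ s : Fin (2 * K) → ℤ, (∀ i, s i ∈ constellation q) →
      errorProb D P τ r s ≤ ENNReal.ofReal
        (C₀ / (κ * codeSigmaMin (infiniteCode D) ^ 2) ^ (nt * nr) / P ^ (nt * nr)) := by
  obtain ⟨C, hC, hnoise⟩ := exists_noisePower_le K
  have hK' : (0 : ℝ) < K := Nat.cast_pos.mpr hK
  have hnt' : (0 : ℝ) < nt := Nat.cast_pos.mpr hnt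
  -- The first constant is read off from 1/(32v) at v = nt/(2P) · C²/(σ²F), where F is the squared
  -- Frobenius norm of the channel.
  refine ⟨1 / (16 * nt * C ^ 2), 4 * K + Real.exp (6 * K), by positivity, by positivity,
    fun D hD hNVS q τ P hP r hr s hs => ?_⟩
  set σ := codeSigmaMin (infiniteCode D) with hσ
  have hσ0 : 0 < σ := lt_of_le_of_ne (codeSigmaMin_nonneg _) (Ne.symm hNVS)
  set t := 1 / (16 * nt * C ^ 2) * σ ^ 2 * P with ht
  have ht0 : 0 < t := by positivity
  have hcond : ∀ H : Fin nr → Fin nt → ℂ,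
      gaussianMatrix nr T {Z | step1 D P τ (r (Matrix.of H)) (Matrix.of H) s (Matrix.of Z) ≠
        (r (Matrix.of H)).A *ᵥ s} ≤ ENNReal.ofReal (4 * K + Real.exp (6 * K)) *
          ENNReal.ofReal (Real.exp (-t * ∑ i, ∑ j, ‖H i j‖ ^ 2)) := by
    intro H
    rw [← ENNReal.ofReal_mul (by positivity)]
    set F := ∑ i, ∑ j, ‖H i j‖ ^ 2 with hF
    have hF0 : 0 ≤ F := Finset.sum_nonneg fun i _ => Finset.sum_nonneg fun j _ => sq_nonneg _
    -- The zero channel gives no positive minimum distance, but there the bound is at least 1.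
    rcases hF0.eq_or_lt with h0 | hFpos
    · refine prob_le_one.trans ?_
      rw [← h0, mul_zero, Real.exp_zero, mul_one, ← ENNReal.ofReal_one]
      exact ENNReal.ofReal_le_ofReal (by linarith [Real.one_le_exp (by positivity : 0 ≤ 6 * (K : ℝ))])
    have hl : 0 < σ * √F := mul_pos hσ0 (Real.sqrt_pos.mpr hFpos)
    have hsq : (σ * √F) ^ 2 = σ ^ 2 * F := by rw [mul_pow, Real.sq_sqrt hF0]
    have hN := hnoise nt q (effChannel D (Matrix.of H)) (avgEnergy q τ) P (σ * √F)
      (r (Matrix.of H)) hP hl (fun d hd => by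
        rw [hsq]
        exact sq_mul_frobenius_le_effChannel hD (Matrix.of H) hd) (hr _)
    have hv : 0 < nt / (2 * P) * (C / (σ * √F)) ^ 2 := by positivity
    refine (gaussianMatrix_step1_ne_le hnt hK D hP τ _ _ hs hv hN).trans (le_of_eq ?_)
    congr 3
    rw [div_pow, hsq, ht]
    field_simp
    norm_num
  -- The domination is pointwise in the channel, so the receiver may depend on it without any
  -- measurability.
  refine (lintegral_mono hcond).trans ?_
  rw [lintegral_const_mul' _ _ ENNReal.ofReal_ne_top, lintegral_exp_neg_frobenius ht0.le,
    ← ENNReal.ofReal_mul (by positivity)]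
  refine ENNReal.ofReal_le_ofReal ?_
  rw [div_div, ← mul_pow, ← ht, mul_comm nr nt, one_div, inv_pow, div_eq_mul_inv]
  refine mul_le_mul_of_nonneg_left ?_ (by positivity)
  exact inv_anti₀ (by positivity) (pow_le_pow_left₀ ht0.le (by linarith) _)

/-- A polynomial upper bound on the error probability bounds the diversity order from below. -/
theorem le_diversityOrder {pe : ℝ → ℝ≥0∞} {c : ℝ} (hc : 0 < c) (N : ℕ)
    (h : ∀ P : ℝ, 0 < P → pe P ≤ ENNReal.ofReal (c / P ^ N)) :
    (N : EReal) ≤ diversityOrder pe := by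
  have hlim : Tendsto (fun P : ℝ => (N : ℝ) - Real.log c / Real.log P) atTop (nhds N) := by
    simpa using (tendsto_const_nhds (x := (N : ℝ))).sub
      (Real.tendsto_log_atTop.const_div_atTop (Real.log c))
  have hlim' : Tendsto (fun P : ℝ => (((N : ℝ) - Real.log c / Real.log P : ℝ) : EReal)) atTop
      (nhds ((N : ℝ) : EReal)) := (continuous_coe_real_ereal.tendsto _).comp hlim
  rw [diversityOrder, show (N : EReal) = ((N : ℝ) : EReal) by simp, ← hlim'.liminf_eq]
  refine liminf_le_liminf ?_
  -- Beyond 1 the logarithm is positive, so dividing by it preserves the inequality. A vanishing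
  -- error probability is covered by the value ⊤ of its negated logarithm.
  filter_upwards [eventually_gt_atTop 1] with P hP
  have hP0 : 0 < P := by linarith
  have hlog : 0 < Real.log P := Real.log_pos hP
  have h1 : ENNReal.log (pe P) ≤ ((Real.log c - N * Real.log P : ℝ) : EReal) := by
    refine (ENNReal.log_le_log (h P hP0)).trans_eq ?_
    rw [ENNReal.log_ofReal_of_pos (by positivity), Real.log_div hc.ne' (by positivity),
      Real.log_pow]
  have h2 : ((-(Real.log c - N * Real.log P) : ℝ) : EReal) ≤ -ENNReal.log (pe P) := by
    rw [EReal.coe_neg]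
    exact EReal.neg_le_neg_iff.mpr h1
  refine le_trans (le_of_eq ?_) (EReal.div_le_div_right_of_nonneg (EReal.coe_nonneg.mpr hlog.le) h2)
  rw [← EReal.coe_div]
  congr 1
  field_simp
  ring

end IFReceiver

/-- Choosing `c'` as a function of the code, before `D`, expresses that the constant depends on the
infinite code alone; the witness uses it only through its minimum singular value. -/
theorem theorem1 (nt nr T K : ℕ) (hnt : 0 < nt) (hnr : 0 < nr) (hK : 0 < K) :
    ∃ c' : Set (Matrix (Fin nt) (Fin T) ℂ) → ℝ,
      ∀ D : Fin (2 * K) → Matrix (Fin nt) (Fin T) ℂ,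
        LinearIndependent ℤ D → IFReceiver.NVS D →
        ∀ k : ℕ, 1 ≤ k → ∀ τ : ℝ,
        ∀ r : ℝ → Matrix (Fin nr) (Fin nt) ℂ → IFReceiver.Receiver nr T K,
          (∀ P : ℝ, 0 < P → ∀ H : Matrix (Fin nr) (Fin nt) ℂ,
            IFReceiver.IsOptimal nt (2 ^ k) (IFReceiver.effChannel D H)
                (IFReceiver.avgEnergy (2 ^ k) τ) P (r P H) ∨
              IFReceiver.IsHighSNROptimal (2 ^ k) (IFReceiver.effChannel D H) (r P H)) →
          ∀ s : Fin (2 * K) → ℤ, (∀ i, s i ∈ IFReceiver.constellation (2 ^ k)) →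
            (∀ P : ℝ, 0 < P →
              IFReceiver.errorProb D P τ (r P) s ≤
                ENNReal.ofReal (c' (IFReceiver.infiniteCode D) / P ^ (nt * nr))) ∧
            ((nt * nr : ℕ) : EReal) ≤
              IFReceiver.diversityOrder (fun P => IFReceiver.errorProb D P τ (r P) s) := by
  obtain ⟨κ, C₀, hκ, hC₀, h⟩ := IFReceiver.exists_errorProb_le nt nr T K hnt hK
  refine ⟨fun C => C₀ / (κ * IFReceiver.codeSigmaMin C ^ 2) ^ (nt * nr),
    fun D hD hNVS k _ τ r hr s hs => ?_⟩
  have hbound : ∀ P : ℝ, 0 < P → _ := fun P hP =>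
    h D hD hNVS (2 ^ k) τ P hP (r P) (hr P hP) s hs
  have hσ : 0 < IFReceiver.codeSigmaMin (IFReceiver.infiniteCode D) :=
    lt_of_le_of_ne (IFReceiver.codeSigmaMin_nonneg _) (Ne.symm hNVS)
  exact ⟨hbound, IFReceiver.le_diversityOrder (by positivity) _ hbound⟩
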